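/- Let $K$ be a field of characteristic zero, $d\ge 0$, $S=K[X_1,\dots,X_d]$ with its standard $\mathbb Z^d$-grading ($\deg X_i=e_i$), and let $A_{\underline 1}(K)=K\langle X_1,\dots,X_d,\partial_1,\dots,\partial_d\rangle$ be the $d$-th Weyl algebra, $\mathbb Z^d$-graded by $\deg X_i=e_i$, $\deg\partial_i=-e_i$. Let $M=\bigoplus_{\underline u\in\mathbb Z^d}M_{\underline u}$ be a $\mathbb Z^d$-graded $S$-module, and let $M(\underline 1)$ be its shift by $\underline 1=(1,\dots,1)$, so $M(\underline 1)_{\underline u}=M_{\underline u+\underline 1}$. Definitions. For $\underline u\in\mathbb Z^d$ put $\operatorname{supp}_+(\underline u)=\{i: u_i>0\}$. $M$ is *straight* if $\dim_K M_{\underline u}<\infty$ for all $\underline u\in\mathbb Z^d$ and multiplication by $X^{\underline w}$ is a bijection $M_{\underline u}\to M_{\underline w+\underline u}$ for all $\underline u\in\mathbb Z^d$ and $\underline w\in\mathbb N^d$ with $\operatorname{supp}_+(\underline w+\underline u)=\operatorname{supp}_+(\underline u)$. A $\mathbb Z^d$-graded $A_{\underline 1}(K)$-module $N$ is *Eulerian*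 if $X_i\partial_i\, y=u_i y$ for all $\underline u$, all $y\in N_{\underline u}$ and all $1\le i\le d$; it is *generalized Eulerian* if for every $\underline u$ and $y\in N_{\underline u}$ there is an integer $a>0$ with $(X_i\partial_i-u_i)^a y=0$ for all $1\le i\le d$. It is *holonomic* if it is finitely generated over $A_{\underline 1}(K)$ and is either zero or has dimension $d$, the dimension being the degree of the polynomial that agrees with $n\mapsto\dim_K\Gamma_n$ for large $n$, for a good filtration $(\Gamma_n)_{n\ge 0}$ of $N$ with respect to the Bernstein filtration $F_n=\operatorname{span}_K\{X^{\underline\alpha}\partial^{\underline\beta}: |\underline\alpha|+|\underline\beta|\le n\}$ (it does not depend on the choice of $\Gamma$). Theorem. (1) If $M$ is straight, then the $S$-module structure of $M(\underline 1)$ extends to an $A_{\underline 1}(K)$-module structure, with $\partial_i$ acting as zero on $M_{\underline u}$ whenever $u_i=1$, for which $M(\underline 1)$ is a $\mathbb Z^d$-graded Eulerian holonomic $A_{\underline 1}(K)$-module. (2) Conversely, if the $S$-module structure of $M(\underline 1)$ extends to an $A_{\underline 1}(K)$-module structure for which $M(\underline 1)$ is a $\mathbb Z^d$-graded generalized Eulerian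 holonomic $A_{\underline 1}(K)$-module, then $M$ is straight. -/

import Mathlib

/-- The defining relations of the Weyl algebra on the free algebra with generators `inl i` (for the
variable `X i`) and `inr i` (for the partial derivative `∂ i`): the `X i` commute, the `∂ i` commute,
and `∂ i * X j - X j * ∂ i = δ_{ij}`. -/
inductive WeylRel (K : Type*) [Field K] (d : ℕ) :
    FreeAlgebra K (Fin d ⊕ Fin d) → FreeAlgebra K (Fin d ⊕ Fin d) → Prop
  | xx (i j : Fin d) : WeylRel K d
      (FreeAlgebra.ι K (Sum.inl i) * FreeAlgebra.ι K (Sum.inl j))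
      (FreeAlgebra.ι K (Sum.inl j) * FreeAlgebra.ι K (Sum.inl i))
  | dd (i j : Fin d) : WeylRel K d
      (FreeAlgebra.ι K (Sum.inr i) * FreeAlgebra.ι K (Sum.inr j))
      (FreeAlgebra.ι K (Sum.inr j) * FreeAlgebra.ι K (Sum.inr i))
  | dx (i j : Fin d) : WeylRel K d
      (FreeAlgebra.ι K (Sum.inr i) * FreeAlgebra.ι K (Sum.inl j))
      (FreeAlgebra.ι K (Sum.inl j) * FreeAlgebra.ι K (Sum.inr i) + if i = j then 1 else 0)

/-- The `d`-th Weyl algebra `K⟨X₁, …, X_d, ∂₁, …, ∂_d⟩`. -/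
def WeylAlgebra (K : Type*) [Field K] (d : ℕ) : Type _ := RingQuot (WeylRel K d)

namespace WeylAlgebra

variable (K : Type*) [Field K] (d : ℕ)

instance instRing : Ring (WeylAlgebra K d) := inferInstanceAs (Ring (RingQuot (WeylRel K d)))

instance instAlgebra : Algebra K (WeylAlgebra K d) :=
  inferInstanceAs (Algebra K (RingQuot (WeylRel K d)))

variable {d}

/-- The generators of the Weyl algebra: `gen (inl i) = X i` and `gen (inr i) = ∂ i`. -/
def gen (s : Fin d ⊕ Fin d) : WeylAlgebra K d :=
  RingQuot.mkAlgHom K (WeylRel K d) (FreeAlgebra.ι K s)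

/-- The variable `X i` in the Weyl algebra. -/
def x (i : Fin d) : WeylAlgebra K d := gen K (Sum.inl i)

/-- The partial derivative `∂ i` in the Weyl algebra. -/
def del (i : Fin d) : WeylAlgebra K d := gen K (Sum.inr i)

/-- The Euler operator `ε i = X i * ∂ i`. -/
def euler (i : Fin d) : WeylAlgebra K d := x K i * del K i

/-- The multidegree of a generator: `deg (X i) = e i` and `deg (∂ i) = -e i`. -/
def genDegree : Fin d ⊕ Fin d → (Fin d → ℤ)
  | Sum.inl i => Pi.single i 1
  | Sum.inr i => -Pi.single i 1

/-- The natural `ℤ^d`-grading of the Weyl algebra: the component of degree `u` is spanned by the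
words in the generators whose total multidegree is `u`. -/
def grading (u : Fin d → ℤ) : Submodule K (WeylAlgebra K d) :=
  Submodule.span K
    {a | ∃ l : List (Fin d ⊕ Fin d), (l.map genDegree).sum = u ∧ (l.map (gen K)).prod = a}

variable (d)

/-- The Bernstein filtration: the `n`-th step is spanned by the words of length at most `n` in the
generators (equivalently, by the `X^α ∂^β` with `|α| + |β| ≤ n`). -/
def bernstein (n : ℕ) : Submodule K (WeylAlgebra K d) :=
  Submodule.span K {a | ∃ l : List (Fin d ⊕ Fin d), l.length ≤ n ∧ (l.map (gen K)).prod = a}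

end WeylAlgebra

/-- The standard `ℤ^d`-grading of `K[X₁, …, X_d]`: the component of degree `u` is spanned by `X^u`
when all `u i ≥ 0` and is zero otherwise. -/
noncomputable def polyGrading (K : Type*) [Field K] {d : ℕ} (u : Fin d → ℤ) :
    Submodule K (MvPolynomial (Fin d) K) :=
  Submodule.span K
    {p | ∃ w : Fin d →₀ ℕ, (∀ i, (w i : ℤ) = u i) ∧ MvPolynomial.monomial w 1 = p}

/-- The family `ℳ` makes the `R`-module `M` into a `ℤ^d`-graded module, where `R` is graded by the
family `𝒜`: one has `M = ⨁ u, ℳ u` and `𝒜 u • ℳ v ⊆ ℳ (u + v)`. -/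
structure IsMultigraded {K R M : Type*} [Field K] [Ring R] [Algebra K R] [AddCommGroup M]
    [Module K M] [Module R M] {d : ℕ} (𝒜 : (Fin d → ℤ) → Submodule K R)
    (ℳ : (Fin d → ℤ) → Submodule K M) : Prop where
  isInternal : DirectSum.IsInternal ℳ
  smul_mem : ∀ (u v : Fin d → ℤ), ∀ a ∈ 𝒜 u, ∀ m ∈ ℳ v, a • m ∈ ℳ (u + v)

/-- The grading of the shifted module `M(a)`: one has `M(a)_u = M_{u + a}`. -/
def shiftGrading {K M : Type*} [Field K] [AddCommGroup M] [Module K M] {d : ℕ}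
    (ℳ : (Fin d → ℤ) → Submodule K M) (a : Fin d → ℤ) : (Fin d → ℤ) → Submodule K M :=
  fun u => ℳ (u + a)

/-- `supp₊(u) = {i | u i > 0}`. -/
def suppPos {d : ℕ} (u : Fin d → ℤ) : Set (Fin d) := {i | 0 < u i}

/-- A `ℤ^d`-graded `K[X₁, …, X_d]`-module with components `ℳ u` is straight: the components are
finite dimensional, and multiplication by `X^w` is a bijection `M_u → M_{w + u}` whenever
`supp₊(w + u) = supp₊(u)`. -/
structure IsStraight {K M : Type*} [Field K] [AddCommGroup M] [Module K M] {d : ℕ}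
    [Module (MvPolynomial (Fin d) K) M] (ℳ : (Fin d → ℤ) → Submodule K M) : Prop where
  finite : ∀ u, Module.Finite K (ℳ u)
  bijOn : ∀ (u : Fin d → ℤ) (w : Fin d →₀ ℕ),
    suppPos ((fun i => (w i : ℤ)) + u) = suppPos u →
      Set.BijOn (fun y : M => (MvPolynomial.monomial w (1 : K) : MvPolynomial (Fin d) K) • y)
        (ℳ u) (ℳ ((fun i => (w i : ℤ)) + u))

/-- Eulerian: `ε i • y = u i • y` for every `y` of multidegree `u` and every `i`. -/
def IsEulerian {K M : Type*} [Field K] [AddCommGroup M] [Module K M] {d : ℕ}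
    [Module (WeylAlgebra K d) M] (ℳ : (Fin d → ℤ) → Submodule K M) : Prop :=
  ∀ (u : Fin d → ℤ), ∀ y ∈ ℳ u, ∀ i : Fin d, WeylAlgebra.euler K i • y = u i • y

/-- Generalized Eulerian: for every `y` of multidegree `u` there is `a > 0` such that
`(ε i - u i)^a • y = 0` for every `i`. -/
def IsGeneralizedEulerian {K M : Type*} [Field K] [AddCommGroup M] [Module K M] {d : ℕ}
    [Module (WeylAlgebra K d) M] (ℳ : (Fin d → ℤ) → Submodule K M) : Prop :=
  ∀ (u : Fin d → ℤ), ∀ y ∈ ℳ u, ∃ a : ℕ, 0 < a ∧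
    ∀ i : Fin d, (WeylAlgebra.euler K i - (u i : WeylAlgebra K d)) ^ a • y = 0

/-- A good filtration on a module over the Weyl algebra with respect to the Bernstein filtration `F`:
an increasing exhaustive filtration by finite dimensional `K`-subspaces with
`F m • Γ n ⊆ Γ (m + n)` for all `m, n` and with equality once `n` is large (for filtrations of this
kind this says that the associated graded module is finitely generated). -/
structure IsGoodFiltration (K : Type*) {M : Type*} [Field K] [AddCommGroup M] [Module K M] (d : ℕ)
    [Module (WeylAlgebra K d) M] (Γ : ℕ → Submodule K M) : Prop where
  mono : Monotone Γ
  exhaustive : ∀ m : M, ∃ n, m ∈ Γ n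
  finite : ∀ n, Module.Finite K (Γ n)
  smul_mem : ∀ m n, ∀ a ∈ WeylAlgebra.bernstein K d m, ∀ y ∈ Γ n, a • y ∈ Γ (m + n)
  good : ∃ n₀, ∀ m n, n₀ ≤ n →
    Γ (m + n) = Submodule.span K
      {z | ∃ a ∈ WeylAlgebra.bernstein K d m, ∃ y ∈ Γ n, a • y = z}

/-- The module `M` over the Weyl algebra has (Bernstein) dimension `k`: for a good filtration `Γ` on
`M`, the function `n ↦ dim_K (Γ n)` agrees for large `n` with a polynomial of degree `k`. The degree
is the same for all good filtrations. -/
def HasBernsteinDim (K M : Type*) [Field K] [AddCommGroup M] [Module K M] (d : ℕ)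
    [Module (WeylAlgebra K d) M] (k : ℕ) : Prop :=
  ∃ Γ : ℕ → Submodule K M, IsGoodFiltration K d Γ ∧
    ∃ P : Polynomial ℚ, P.degree = k ∧
      ∀ᶠ n : ℕ in Filter.atTop, (Module.finrank K (Γ n) : ℚ) = P.eval (n : ℚ)

/-- A module over the `d`-th Weyl algebra is holonomic if it is finitely generated and is either zero
or of dimension `d`. -/
def IsHolonomic (K M : Type*) [Field K] [AddCommGroup M] [Module K M] (d : ℕ)
    [Module (WeylAlgebra K d) M] : Prop :=
  Module.Finite (WeylAlgebra K d) M ∧ (Subsingleton M ∨ HasBernsteinDim K M d d)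

/-- The action of the Weyl algebra on `M` extends the action of `K[X₁, …, X_d]`. -/
structure ExtendsPolyAction (K M : Type*) [Field K] [AddCommGroup M] [Module K M] (d : ℕ)
    [Module (MvPolynomial (Fin d) K) M] [Module (WeylAlgebra K d) M] : Prop where
  algebraMap_smul : ∀ (c : K) (m : M), algebraMap K (WeylAlgebra K d) c • m = c • m
  x_smul : ∀ (i : Fin d) (m : M),
    WeylAlgebra.x K i • m = (MvPolynomial.X i : MvPolynomial (Fin d) K) • m

open Module

/-! ### Linear algebra and counting -/

/-! Write `v = u - 1` for the shifted degree. The Euler operator `ε i = X i ∂ i` has only the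
generalized eigenvalue `v i` in degree `v`, so in characteristic zero `X i` and `∂ i` can degenerate
only at the walls between `v i = -1` and `v i = 0`.

Generalized Eulerian to straight: away from `v i = -1`, that is `u i = 0`, `X i` is bijective
(`eq_zero_of_x_smul_eq_zero`, `exists_x_smul_eq`), which is straightness for variables and hence for
monomials. For finiteness, an `r`-dimensional subspace of one component is carried injectively to
all degrees of its orthant. The copies at distance at most `n` are independent and lie in `Γ (n +
k)`, so `r * (n + d).choose d` is at most a polynomial of degree `d` in `n`, which bounds `r`.

Straight to Eulerian: on `ℳ u` let `∂ i` be `(u i - 1)` times the inverse of `X i`, and zero when `u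
i = 1`; the Weyl relations follow by cancelling `X i`. Filter by distance to the cube `{0, 1}^d`.
Off the cube an Euler scalar is nonzero, so each component is reached from a closer one and the
filtration is good. Dimensions are constant along each orthant, so its Hilbert function is a
constant times `(n + d).choose d`. -/

lemma finrank_iSup_of_iSupIndep {K M ι : Type*} [Field K] [AddCommGroup M] [Module K M] [Fintype ι]
    {p : ι → Submodule K M} (h : iSupIndep p) [∀ i, Module.Finite K (p i)] :
    finrank K ↥(⨆ i, p i) = ∑ i, finrank K (p i) := by
  classical
  rw [← Module.finrank_directSum, Submodule.iSup_eq_range_dfinsupp_lsum]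
  exact (LinearEquiv.ofInjective _ h.dfinsupp_lsum_injective).finrank_eq.symm

/-- The tuples of natural numbers with sum at most `n`. -/
def boundedTuples (d n : ℕ) : Finset (Fin d → ℕ) :=
  (Finset.range (n + 1)).biUnion fun k => Finset.piAntidiag Finset.univ k

lemma mem_boundedTuples {d n : ℕ} {a : Fin d → ℕ} : a ∈ boundedTuples d n ↔ ∑ i, a i ≤ n := by
  simp [boundedTuples]

lemma card_boundedTuples (d n : ℕ) : (boundedTuples d n).card = (n + d).choose d := by
  rw [boundedTuples, Finset.card_biUnion, ← Nat.sum_range_multichoose]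
  · refine Finset.sum_congr rfl fun k _ => ?_
    rw [← Finset.map_sym_eq_piAntidiag, Finset.card_map, Finset.sym_univ, Finset.card_univ,
      Sym.card_sym_fin_eq_multichoose]
  · intro k _ l _ hkl
    rw [Function.onFun, Finset.disjoint_left]
    intro f hf hf'
    simp only [Finset.mem_piAntidiag] at hf hf'
    exact hkl (hf.1.symm.trans hf'.1)

lemma eval_preHilbertPoly_zero (d n : ℕ) :
    (Polynomial.preHilbertPoly ℚ d 0).eval (n : ℚ) = ((boundedTuples d n).card : ℚ) := by
  rw [Polynomial.preHilbertPoly_eq_choose_sub_add ℚ d (Nat.zero_le n), card_boundedTuples,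
    Nat.sub_zero]

lemma degree_preHilbertPoly_zero (d : ℕ) : (Polynomial.preHilbertPoly ℚ d 0).degree = d := by
  have h : Polynomial.preHilbertPoly ℚ d 0 ≠ 0 := by
    rw [← Polynomial.leadingCoeff_ne_zero, Polynomial.leadingCoeff_preHilbertPoly]
    positivity
  rw [Polynomial.degree_eq_natDegree h, Polynomial.natDegree_preHilbertPoly]

/-- A polynomial of degree `d` dominates only boundedly many copies of the Hilbert polynomial of
the polynomial ring in `d` variables, even after a translation of the argument. -/
lemma exists_bound_of_degree_eq {d : ℕ} {P : Polynomial ℚ} (hP : P.degree = d) :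
    ∃ B : ℕ, ∀ r k : ℕ,
      (∀ᶠ n : ℕ in Filter.atTop,
        (r : ℚ) * (boundedTuples d n).card ≤ P.eval ((k + n : ℕ) : ℚ)) → r ≤ B := by
  -- Translating the argument by `k` keeps the leading coefficient, so one bound serves all `k`.
  obtain ⟨B, hB⟩ := exists_nat_ge (P.leadingCoeff / (Polynomial.preHilbertPoly ℚ d 0).leadingCoeff)
  refine ⟨B, fun r k h => ?_⟩
  have hdeg : (P.comp (Polynomial.X + Polynomial.C (k : ℚ))).degree =
      (Polynomial.preHilbertPoly ℚ d 0).degree := by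
    rw [degree_preHilbertPoly_zero, ← Polynomial.taylor_apply, Polynomial.degree_taylor, hP]
  have ht := (Polynomial.div_tendsto_atTop_leadingCoeff_div_of_degree_eq _ _ hdeg).comp
    (tendsto_natCast_atTop_atTop (R := ℚ))
  have hl : (P.comp (Polynomial.X + Polynomial.C (k : ℚ))).leadingCoeff = P.leadingCoeff := by
    rw [Polynomial.leadingCoeff_comp (by rw [Polynomial.natDegree_X_add_C]; exact one_ne_zero),
      Polynomial.leadingCoeff_X_add_C, one_pow, mul_one]
  rw [hl] at ht
  have : (r : ℚ) ≤ B := by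
    refine le_trans (ge_of_tendsto ht ?_) hB
    filter_upwards [h] with n hn
    have hpos : (0 : ℚ) < (boundedTuples d n).card := by
      rw [card_boundedTuples]
      exact_mod_cast Nat.choose_pos (Nat.le_add_left d n)
    rw [Function.comp_apply, eval_preHilbertPoly_zero, le_div_iff₀ hpos, Polynomial.eval_comp]
    simpa only [Polynomial.eval_add, Polynomial.eval_X, Polynomial.eval_C, add_comm (n : ℚ),
      ← Nat.cast_add] using hn
  exact_mod_cast this

/-- If every finite dimensional subspace has dimension at most `B`, the space is finite
dimensional. -/
lemma Module.finite_of_forall_finrank_le {K M : Type*} [Field K] [AddCommGroup M] [Module K M]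
    (B : ℕ) (h : ∀ V : Submodule K M, Module.Finite K V → finrank K V ≤ B) :
    Module.Finite K M := by
  rw [← Module.rank_lt_aleph0_iff]
  by_contra hc
  obtain ⟨s, hs, hli⟩ := exists_finset_linearIndependent_of_le_rank (R := K) (M := M) (n := B + 1)
    (Cardinal.natCast_le_aleph0.trans (not_lt.mp hc))
  have h1 := h (Submodule.span K (s : Set M)) inferInstance
  have h2 := finrank_span_finset_eq_card hli
  omega

/-! ### Relations, words and Bernstein filtration of the Weyl algebra -/

namespace WeylAlgebra

variable {K : Type*} [Field K] {d : ℕ}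

lemma del_mul_x (i j : Fin d) :
    del K i * x K j = x K j * del K i + if i = j then 1 else 0 := by
  have := RingQuot.mkAlgHom_rel K (WeylRel.dx (K := K) i j)
  rw [map_add, map_mul, map_mul] at this
  refine this.trans (congrArg₂ _ rfl ?_)
  split_ifs
  · exact map_one _
  · exact map_zero _

lemma prod_gen_mem_bernstein (l : List (Fin d ⊕ Fin d)) :
    (l.map (gen K)).prod ∈ bernstein K d l.length :=
  Submodule.subset_span ⟨l, le_rfl, rfl⟩

lemma one_mem_bernstein (n : ℕ) : (1 : WeylAlgebra K d) ∈ bernstein K d n :=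
  Submodule.subset_span ⟨[], Nat.zero_le _, rfl⟩

lemma bernstein_mono : Monotone (bernstein K d) := fun _ _ h =>
  Submodule.span_mono fun _ ⟨l, hl, e⟩ => ⟨l, hl.trans h, e⟩

lemma gen_mem_bernstein (s : Fin d ⊕ Fin d) : gen K s ∈ bernstein K d 1 := by
  simpa using prod_gen_mem_bernstein (K := K) [s]

lemma mul_mem_bernstein {m n : ℕ} {a b : WeylAlgebra K d} (ha : a ∈ bernstein K d m)
    (hb : b ∈ bernstein K d n) : a * b ∈ bernstein K d (m + n) := by
  have := Submodule.mul_mem_mul ha hb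
  rw [bernstein, bernstein, Submodule.span_mul_span] at this
  refine Submodule.span_mono ?_ this
  rintro _ ⟨_, ⟨l, hl, rfl⟩, _, ⟨l', hl', rfl⟩, rfl⟩
  exact ⟨l ++ l', by simp; omega, by simp⟩

lemma gen_mem_grading (s : Fin d ⊕ Fin d) : gen K s ∈ grading K (genDegree s) :=
  Submodule.subset_span ⟨[s], by simp, by simp⟩

end WeylAlgebra

/-! ### Graded generalized Eulerian holonomic modules are straight -/

lemma eq_zero_of_zsmul_eq_zero_of_charZero (K : Type*) [Field K] [CharZero K] {M : Type*}
    [AddCommGroup M] [Module K M] {n : ℤ} (hn : n ≠ 0) {y : M} (h : n • y = 0) : y = 0 := by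
  rw [← Int.cast_smul_eq_zsmul K] at h
  exact (smul_eq_zero.mp h).resolve_left (Int.cast_ne_zero.mpr hn)

/-- An eigenvector for `k` which is a generalized eigenvector for `c ≠ k` vanishes. -/
lemma eq_zero_of_smul_eq_of_pow_smul_eq_zero (K : Type*) [Field K] [CharZero K] {R M : Type*}
    [Ring R] [AddCommGroup M] [Module K M] [Module R M] (T : R) {c k : ℤ} (hck : k ≠ c) (a : ℕ)
    {y : M} (hk : T • y = k • y) (ha : (T - (c : R)) ^ a • y = 0) : y = 0 := by
  have h1 : (T - (c : R)) • y = (k - c) • y := by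
    rw [sub_smul, sub_smul, hk, Int.cast_smul_eq_zsmul]
  have key : (T - (c : R)) ^ a • y = (k - c) ^ a • y := by
    clear ha
    induction a with
    | zero => simp
    | succ a ih => rw [pow_succ, mul_smul, h1, smul_comm, ih, smul_smul, pow_succ, mul_comm]
  rw [key] at ha
  exact eq_zero_of_zsmul_eq_zero_of_charZero K (pow_ne_zero a (sub_ne_zero.mpr hck)) ha

/-- A generalized eigenvector for `c ≠ 0` in a `T`-stable subspace `N` lies in `T N`. -/
lemma exists_smul_eq_of_pow_smul_eq_zero {K : Type*} [Field K] [CharZero K] {R M : Type*}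
    [Ring R] [AddCommGroup M] [Module K M] [Module R M] [SMulCommClass R K M] (T : R) {c : ℤ}
    (hc : c ≠ 0) (N : Submodule K M) (hN : ∀ y ∈ N, T • y ∈ N) (a : ℕ) :
    ∀ y ∈ N, (T - (c : R)) ^ a • y = 0 → ∃ z ∈ N, T • z = y := by
  induction a with
  | zero =>
    intro y _ h
    rw [pow_zero, one_smul] at h
    exact ⟨0, N.zero_mem, by rw [h, smul_zero]⟩
  | succ a ih =>
    intro y hy h
    rw [pow_succ, mul_smul] at h
    have hmem : (T - (c : R)) • y ∈ N := by
      rw [sub_smul, Int.cast_smul_eq_zsmul]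
      exact N.sub_mem (hN y hy) (zsmul_mem hy c)
    obtain ⟨w, hw, hw'⟩ := ih _ hmem h
    -- Since `T w = T y - c y`, one has `T (y - w) = c y`.
    refine ⟨(c : K)⁻¹ • (y - w), N.smul_mem _ (N.sub_mem hy hw), ?_⟩
    rw [smul_comm, smul_sub, hw', sub_smul, sub_sub_cancel, Int.cast_smul_eq_zsmul,
      ← Int.cast_smul_eq_zsmul K, smul_smul, inv_mul_cancel₀ (Int.cast_ne_zero.mpr hc), one_smul]

namespace WeylAlgebra

variable {K : Type*} [Field K] {d : ℕ} {M : Type*} [AddCommGroup M] [Module K M]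
  [Module (WeylAlgebra K d) M] {𝒩 : (Fin d → ℤ) → Submodule K M}

lemma x_smul_mem (h𝒩 : IsMultigraded (grading K) 𝒩)
    {v : Fin d → ℤ} {y : M} (hy : y ∈ 𝒩 v) (i : Fin d) : x K i • y ∈ 𝒩 (v + Pi.single i 1) := by
  rw [add_comm]
  exact h𝒩.smul_mem _ _ _ (gen_mem_grading (Sum.inl i)) _ hy

lemma del_smul_mem (h𝒩 : IsMultigraded (grading K) 𝒩)
    {v : Fin d → ℤ} {y : M} (hy : y ∈ 𝒩 v) (i : Fin d) :
    del K i • y ∈ 𝒩 (v - Pi.single i 1) := by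
  rw [sub_eq_add_neg, add_comm]
  exact h𝒩.smul_mem _ _ _ (gen_mem_grading (Sum.inr i)) _ hy

variable [CharZero K]

/-- If `∂ i` kills `y`, then `y` is an eigenvector of `ε i` for `0`, whereas its only generalized
eigenvalue is `v i`. -/
lemma eq_zero_of_del_smul_eq_zero (hgen : IsGeneralizedEulerian 𝒩) {v : Fin d → ℤ} {i : Fin d}
    (hv : v i ≠ 0) {y : M} (hy : y ∈ 𝒩 v) (h : del K i • y = 0) : y = 0 := by
  obtain ⟨a, -, ha⟩ := hgen v y hy
  refine eq_zero_of_smul_eq_of_pow_smul_eq_zero K (euler K i) hv.symm a ?_ (ha i)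
  rw [euler, mul_smul, h, smul_zero, zero_smul]

/-- Since `∂ i X i = ε i + 1`, a vector killed by `X i` is an eigenvector of `ε i` for `-1`. -/
lemma eq_zero_of_x_smul_eq_zero (hgen : IsGeneralizedEulerian 𝒩) {v : Fin d → ℤ} {i : Fin d}
    (hv : v i ≠ -1) {y : M} (hy : y ∈ 𝒩 v) (h : x K i • y = 0) : y = 0 := by
  obtain ⟨a, -, ha⟩ := hgen v y hy
  refine eq_zero_of_smul_eq_of_pow_smul_eq_zero K (euler K i) hv.symm a ?_ (ha i)
  have h1 : (del K i * x K i) • y = 0 := by rw [mul_smul, h, smul_zero]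
  rw [del_mul_x, if_pos rfl, add_smul, one_smul] at h1
  rw [neg_one_smul]
  exact eq_neg_of_add_eq_zero_left h1

/-- In degree `v + e i` the operator `ε i = X i ∂ i` has the nonzero generalized eigenvalue `v i +
1`, hence is onto; `∂ i` of a preimage under it is the required element. -/
lemma exists_x_smul_eq [SMulCommClass (WeylAlgebra K d) K M] (h𝒩 : IsMultigraded (grading K) 𝒩)
    (hgen : IsGeneralizedEulerian 𝒩) {v : Fin d → ℤ}
    {i : Fin d} (hv : v i ≠ -1) {y : M} (hy : y ∈ 𝒩 (v + Pi.single i 1)) :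
    ∃ z ∈ 𝒩 v, x K i • z = y := by
  obtain ⟨a, -, ha⟩ := hgen _ y hy
  obtain ⟨z, hz, hzy⟩ := exists_smul_eq_of_pow_smul_eq_zero (euler K i)
    (c := (v + Pi.single i 1 : Fin d → ℤ) i) (by simp; omega) (𝒩 (v + Pi.single i 1))
    (fun z hz => by
      have := x_smul_mem h𝒩 (del_smul_mem h𝒩 hz i) i
      rwa [sub_add_cancel, ← mul_smul] at this) a y hy (ha i)
  refine ⟨del K i • z, ?_, by rw [← mul_smul]; exact hzy⟩
  simpa using del_smul_mem h𝒩 hz i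

/-- The direction in which the coordinate `i` moves away from `{-1, 0}`, starting from `v i`. -/
def orthantSign (v : Fin d → ℤ) (i : Fin d) : ℤ := if 0 ≤ v i then 1 else -1

/-- Moving outwards never leaves the orthant, so the operators for successive moves can be composed.
-/
lemma orthantSign_add (v : Fin d → ℤ) (a : Fin d →₀ ℕ) :
    orthantSign (v + fun i => orthantSign v i * (a i : ℤ)) = orthantSign v := by
  funext i
  simp only [orthantSign, Pi.add_apply]
  split_ifs <;> omega

/-- For every `a` there is an operator of length `|a|` moving a component of multidegree `v`
by `a` inside its orthant injectively. -/
lemma exists_injective_operator (h𝒩 : IsMultigraded (grading K) 𝒩)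
    (hgen : IsGeneralizedEulerian 𝒩) (a : Fin d →₀ ℕ) :
    ∀ v : Fin d → ℤ, ∃ b ∈ bernstein K d (∑ i, a i),
      ∀ y ∈ 𝒩 v, b • y ∈ 𝒩 (v + fun i => orthantSign v i * (a i : ℤ)) ∧ (b • y = 0 → y = 0) := by
  have hadd : ∀ a a' : Fin d →₀ ℕ,
      (∀ v : Fin d → ℤ, ∃ b ∈ bernstein K d (∑ i, a i),
        ∀ y ∈ 𝒩 v, b • y ∈ 𝒩 (v + fun i => orthantSign v i * (a i : ℤ)) ∧ (b • y = 0 → y = 0)) →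
      (∀ v : Fin d → ℤ, ∃ b ∈ bernstein K d (∑ i, a' i),
        ∀ y ∈ 𝒩 v, b • y ∈ 𝒩 (v + fun i => orthantSign v i * (a' i : ℤ)) ∧ (b • y = 0 → y = 0)) →
      ∀ v : Fin d → ℤ, ∃ b ∈ bernstein K d (∑ i, (a + a') i),
        ∀ y ∈ 𝒩 v, b • y ∈ 𝒩 (v + fun i => orthantSign v i * ((a + a') i : ℤ)) ∧
          (b • y = 0 → y = 0) := by
    intro a a' h h' v
    obtain ⟨b, hb, hby⟩ := h v
    obtain ⟨b', hb', hby'⟩ := h' (v + fun i => orthantSign v i * (a i : ℤ))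
    refine ⟨b' * b, ?_, fun y hy => ?_⟩
    · simp only [Finsupp.add_apply, Finset.sum_add_distrib]
      rw [add_comm]
      exact mul_mem_bernstein hb' hb
    · obtain ⟨h1, h2⟩ := hby y hy
      obtain ⟨h3, h4⟩ := hby' _ h1
      rw [orthantSign_add, ← mul_smul] at h3
      refine ⟨?_, fun h0 => h2 (h4 (by rw [← mul_smul, h0]))⟩
      convert h3 using 2
      rw [add_assoc]
      congr 1
      funext i
      simp [mul_add]
  induction a using Finsupp.induction_linear with
  | zero => exact fun v => ⟨1, one_mem_bernstein _, fun y hy => by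
      simpa [show (fun _ : Fin d => (0 : ℤ)) = 0 from rfl] using hy⟩
  | add a a' h h' => exact hadd a a' h h'
  | single i k =>
    induction k with
    | zero => exact fun v => ⟨1, one_mem_bernstein _, fun y hy => by
        simpa [show (fun _ : Fin d => (0 : ℤ)) = 0 from rfl] using hy⟩
    | succ k ih =>
      rw [Finsupp.single_add]
      refine hadd _ _ ih fun v => ?_
      have hsum : ∑ j, (Finsupp.single i 1 : Fin d →₀ ℕ) j = 1 := by
        simp [Finsupp.single_apply]
      rw [hsum]
      -- Step outwards: `X i` is injective because `v i ≠ -1`, and in the other case `∂ i` is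
      -- because `v i ≠ 0`.
      by_cases hv : 0 ≤ v i
      · refine ⟨gen K (Sum.inl i), gen_mem_bernstein _, fun y hy =>
          ⟨?_, eq_zero_of_x_smul_eq_zero hgen (by omega) hy⟩⟩
        rw [show gen K (Sum.inl i) • y = x K i • y from rfl]
        convert x_smul_mem h𝒩 hy i using 3
        funext j
        rcases eq_or_ne i j with rfl | hij
        · simp [orthantSign, hv]
        · simp [hij.symm]
      · refine ⟨gen K (Sum.inr i), gen_mem_bernstein _, fun y hy =>
          ⟨?_, eq_zero_of_del_smul_eq_zero hgen (by omega) hy⟩⟩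
        rw [show gen K (Sum.inr i) • y = del K i • y from rfl]
        convert del_smul_mem h𝒩 hy i using 2
        rw [sub_eq_add_neg]
        congr 1
        funext j
        rcases eq_or_ne i j with rfl | hij
        · simp [orthantSign, hv]
        · simp [hij.symm]

/-- The components of a graded generalized Eulerian module of Bernstein dimension `d` are finite
dimensional. -/
lemma finite_of_isGeneralizedEulerian [IsScalarTower K (WeylAlgebra K d) M]
    (h𝒩 : IsMultigraded (grading K) 𝒩) (hgen : IsGeneralizedEulerian 𝒩)
    (hdim : HasBernsteinDim K M d d) (v : Fin d → ℤ) : Module.Finite K (𝒩 v) := by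
  obtain ⟨Γ, hΓ, P, hP, hPΓ⟩ := hdim
  obtain ⟨B, hB⟩ := exists_bound_of_degree_eq hP
  refine Module.finite_of_forall_finrank_le B fun V hV => ?_
  set W : Submodule K M := V.map (𝒩 v).subtype with hW
  have hWle : W ≤ 𝒩 v := Submodule.map_subtype_le _ _
  have hWr : finrank K W = finrank K V :=
    (Submodule.equivMapOfInjective _ (𝒩 v).injective_subtype V).finrank_eq.symm
  have hWfg : W.FG := (Module.Finite.iff_fg.mp hV).map _
  obtain ⟨k, hk⟩ : ∃ k, W ≤ Γ k := by
    obtain ⟨s, hs⟩ := hWfg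
    choose f hf using hΓ.exhaustive
    refine ⟨s.sup f, ?_⟩
    rw [← hs, Submodule.span_le]
    exact fun y hy => hΓ.mono (Finset.le_sup hy) (hf y)
  have hWfin : Module.Finite K W := Module.Finite.iff_fg.mpr hWfg
  choose b hb hby using fun a : Fin d → ℕ =>
    exists_injective_operator h𝒩 hgen (Finsupp.equivFunOnFinite.symm a) v
  let p : (Fin d → ℕ) → Submodule K M := fun a => LinearMap.range ((Algebra.lsmul K K M (b a)).domRestrict W)
  have hinj : Function.Injective fun a : Fin d → ℕ => v + fun i => orthantSign v i * (a i : ℤ) := by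
    intro a a' h
    funext i
    have := congrFun h i
    simp only [Pi.add_apply, orthantSign] at this
    split_ifs at this <;> omega
  -- The copies `p a` of `W` lie in pairwise distinct degrees.
  have hind : iSupIndep p := by
    refine (h𝒩.isInternal.submodule_iSupIndep.comp hinj).mono fun a => ?_
    rintro _ ⟨y, rfl⟩
    exact (hby a y (hWle y.2)).1
  have hp : ∀ a, finrank K (p a) = finrank K W := fun a => by
    refine LinearMap.finrank_range_of_inj ((injective_iff_map_eq_zero _).mpr fun y hy => ?_)
    exact Subtype.ext ((hby a y (hWle y.2)).2 hy)
  refine hB _ k ?_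
  filter_upwards [(Filter.tendsto_add_atTop_nat k).eventually hPΓ] with n hn
  rw [add_comm k n, ← hn]
  have hle : (⨆ a : boundedTuples d n, p a) ≤ Γ (n + k) := by
    refine iSup_le fun a => ?_
    rintro _ ⟨y, rfl⟩
    refine hΓ.smul_mem n k _ (bernstein_mono ?_ (hb a)) y (hk y.2)
    exact mem_boundedTuples.mp a.2
  have := hΓ.finite (n + k)
  have hr := Submodule.finrank_mono hle
  rw [finrank_iSup_of_iSupIndep (p := fun a : boundedTuples d n => p a)
    (hind.comp Subtype.coe_injective)] at hr
  simp only [hp, hWr, Finset.sum_const, Finset.card_univ, Fintype.card_coe, smul_eq_mul] at hr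
  rw [mul_comm]
  exact_mod_cast hr

end WeylAlgebra

/-- Adding natural numbers only increases coordinates, so a sign change at the intermediate degree
would persist to the end. -/
lemma suppPos_eq_of_suppPos_add_add_eq {d : ℕ} {u : Fin d → ℤ} {w w' : Fin d →₀ ℕ}
    (h : suppPos ((fun i => ((w + w') i : ℤ)) + u) = suppPos u) :
    suppPos ((fun i => (w i : ℤ)) + u) = suppPos u := by
  ext i
  have := Set.ext_iff.mp h i
  simp only [suppPos, Set.mem_ofPred_eq, Pi.add_apply, Finsupp.add_apply, Nat.cast_add] at this ⊢
  omega

/-- To check bijectivity of all the multiplications in the definition of straightness, it suffices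
to consider the variables. -/
lemma bijOn_monomial_of_bijOn_X {K M : Type*} [Field K] [AddCommGroup M] [Module K M] {d : ℕ}
    [Module (MvPolynomial (Fin d) K) M] {ℳ : (Fin d → ℤ) → Submodule K M}
    (h : ∀ (u : Fin d → ℤ) (i : Fin d), u i ≠ 0 →
      Set.BijOn (fun y : M => (MvPolynomial.X i : MvPolynomial (Fin d) K) • y)
        (ℳ u) (ℳ (Pi.single i 1 + u)))
    (w : Fin d →₀ ℕ) : ∀ u : Fin d → ℤ, suppPos ((fun i => (w i : ℤ)) + u) = suppPos u →
      Set.BijOn (fun y : M => (MvPolynomial.monomial w (1 : K) : MvPolynomial (Fin d) K) • y)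
        (ℳ u) (ℳ ((fun i => (w i : ℤ)) + u)) := by
  have hadd : ∀ w w' : Fin d →₀ ℕ,
      (∀ u : Fin d → ℤ, suppPos ((fun i => (w i : ℤ)) + u) = suppPos u →
        Set.BijOn (fun y : M => (MvPolynomial.monomial w (1 : K) : MvPolynomial (Fin d) K) • y)
          (ℳ u) (ℳ ((fun i => (w i : ℤ)) + u))) →
      (∀ u : Fin d → ℤ, suppPos ((fun i => (w' i : ℤ)) + u) = suppPos u →
        Set.BijOn (fun y : M => (MvPolynomial.monomial w' (1 : K) : MvPolynomial (Fin d) K) • y)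
          (ℳ u) (ℳ ((fun i => (w' i : ℤ)) + u))) →
      ∀ u : Fin d → ℤ, suppPos ((fun i => ((w + w') i : ℤ)) + u) = suppPos u →
        Set.BijOn
          (fun y : M => (MvPolynomial.monomial (w + w') (1 : K) : MvPolynomial (Fin d) K) • y)
          (ℳ u) (ℳ ((fun i => ((w + w') i : ℤ)) + u)) := by
    intro w w' hw hw' u hu
    have hu1 := suppPos_eq_of_suppPos_add_add_eq hu
    have hu' : (fun i => ((w + w') i : ℤ)) + u =
        (fun i => (w' i : ℤ)) + ((fun i => (w i : ℤ)) + u) := by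
      funext i
      simp only [Pi.add_apply, Finsupp.add_apply, Nat.cast_add]
      ring
    rw [hu'] at hu ⊢
    refine ((hw' _ (hu.trans hu1.symm)).comp (hw u hu1)).congr fun y _ => ?_
    simp only [Function.comp_apply]
    rw [← mul_smul, MvPolynomial.monomial_mul, one_mul, add_comm]
  have hzero : Set.BijOn (fun y : M => (MvPolynomial.monomial 0 (1 : K) :
      MvPolynomial (Fin d) K) • y) = Set.BijOn id := by
    congr 1
    funext y
    rw [← MvPolynomial.C_apply, map_one, one_smul, id]
  have hu0 : ∀ u : Fin d → ℤ, (fun i => (((0 : Fin d →₀ ℕ) i : ℕ) : ℤ)) + u = u := fun u => by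
    funext i
    simp
  induction w using Finsupp.induction_linear with
  | zero =>
    intro u _
    rw [hzero, hu0]
    exact Set.bijOn_id _
  | add w w' hw hw' => exact hadd w w' hw hw'
  | single i k =>
    induction k with
    | zero =>
      intro u _
      rw [Finsupp.single_zero, hzero, hu0]
      exact Set.bijOn_id _
    | succ k ih =>
      rw [Finsupp.single_add]
      refine hadd _ _ ih fun u hu => ?_
      have hs : (fun j => ((Finsupp.single i 1 : Fin d →₀ ℕ) j : ℤ)) = Pi.single i 1 := by
        funext j
        rcases eq_or_ne i j with rfl | hij
        · simp
        · simp [hij.symm]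
      rw [hs] at hu ⊢
      -- At `u i = 0` the step would add `i` to the positive support.
      refine h u i fun h0 => ?_
      have := Set.ext_iff.mp hu i
      simp [suppPos, h0] at this

/-- A graded module whose shift is a graded generalized Eulerian holonomic module is straight. -/
theorem isStraight_of_isGeneralizedEulerian {K : Type*} [Field K] [CharZero K] {d : ℕ} {M : Type*}
    [AddCommGroup M] [Module K M] [Module (MvPolynomial (Fin d) K) M]
    [Module (WeylAlgebra K d) M] {ℳ : (Fin d → ℤ) → Submodule K M}
    (hE : ExtendsPolyAction K M d)
    (hgr : IsMultigraded (WeylAlgebra.grading K) (shiftGrading ℳ 1))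
    (hgen : IsGeneralizedEulerian (shiftGrading ℳ 1)) (hhol : IsHolonomic K M d) :
    IsStraight ℳ := by
  have : IsScalarTower K (WeylAlgebra K d) M := ⟨fun c a m => by
    rw [Algebra.smul_def, mul_smul, hE.algebraMap_smul]⟩
  have hshift : ∀ u, ℳ u = shiftGrading ℳ 1 (u - 1) := fun u => by
    rw [shiftGrading, sub_add_cancel]
  refine ⟨fun u => ?_, fun u w => bijOn_monomial_of_bijOn_X (fun u i hu => ?_) w u⟩
  · rcases hhol.2 with hM | hdim
    · infer_instance
    · rw [hshift]
      exact WeylAlgebra.finite_of_isGeneralizedEulerian hgr hgen hdim _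
  · have hv : (u - 1) i ≠ -1 := by
      simp only [Pi.sub_apply, Pi.one_apply]
      omega
    simp only [← hE.x_smul]
    rw [hshift u, hshift, show Pi.single i 1 + u - 1 = u - 1 + Pi.single i 1 by abel]
    refine ⟨fun y hy => WeylAlgebra.x_smul_mem hgr hy i, fun y hy z hz hyz => ?_, fun y hy => ?_⟩
    · rw [← sub_eq_zero]
      refine WeylAlgebra.eq_zero_of_x_smul_eq_zero hgen hv (Submodule.sub_mem _ hy hz) (i := i) ?_
      rw [smul_sub, sub_eq_zero]
      exact hyz
    · exact WeylAlgebra.exists_x_smul_eq hgr hgen hv hy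

/-! ### The action of the Weyl algebra on a straight module -/

section Internal

variable {K M ι : Type*} [Field K] [AddCommGroup M] [Module K M] [DecidableEq ι]
  {ℳ : ι → Submodule K M}

lemma DirectSum.IsInternal.exists_linearMap {N : Type*} [AddCommGroup N] [Module K N]
    (h : DirectSum.IsInternal ℳ) (f : ∀ u, ℳ u →ₗ[K] N) :
    ∃ F : M →ₗ[K] N, ∀ u (y : ℳ u), F y = f u y := by
  let e := LinearEquiv.ofBijective (DirectSum.coeLinearMap ℳ) h
  refine ⟨(DirectSum.toModule K ι N f).comp e.symm.toLinearMap, fun u y => ?_⟩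
  have : e.symm (y : M) = DirectSum.lof K ι (fun u => ℳ u) u y := by
    rw [LinearEquiv.symm_apply_eq]
    exact (DirectSum.coeLinearMap_lof ℳ u y).symm
  simp [this]

lemma DirectSum.IsInternal.linearMap_ext {N : Type*} [AddCommGroup N] [Module K N]
    (h : DirectSum.IsInternal ℳ) {f g : M →ₗ[K] N} (hfg : ∀ u, ∀ y ∈ ℳ u, f y = g y) : f = g := by
  refine LinearMap.ext_on_range (v := fun p : Σ u, ℳ u => (p.2 : M)) ?_ fun p => hfg _ _ p.2.2
  rw [eq_top_iff, ← h.submodule_iSup_eq_top, iSup_le_iff]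
  exact fun u y hy => Submodule.subset_span ⟨⟨u, y, hy⟩, rfl⟩

end Internal

namespace WeylAlgebra

variable {K : Type*} [Field K] {d : ℕ} {M : Type*} [AddCommGroup M] [Module K M]

/-- Operators `X i`, `D i` satisfying the relations of the Weyl algebra define a module. -/
lemma exists_module (X D : Fin d → Module.End K M) (hxx : ∀ i j, X i * X j = X j * X i)
    (hdd : ∀ i j, D i * D j = D j * D i)
    (hdx : ∀ i j, D i * X j = X j * D i + if i = j then 1 else 0) :
    ∃ _ : Module (WeylAlgebra K d) M,
      (∀ (c : K) (m : M), algebraMap K (WeylAlgebra K d) c • m = c • m) ∧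
      (∀ (i : Fin d) (m : M), x K i • m = X i m) ∧ ∀ (i : Fin d) (m : M), del K i • m = D i m := by
  let f : FreeAlgebra K (Fin d ⊕ Fin d) →ₐ[K] Module.End K M := FreeAlgebra.lift K (Sum.elim X D)
  have hf : ∀ ⦃a b⦄, WeylRel K d a b → f a = f b := by
    rintro _ _ (⟨i, j⟩ | ⟨i, j⟩ | ⟨i, j⟩)
    · simpa [f] using hxx i j
    · simpa [f] using hdd i j
    · simp only [f, map_mul, map_add, FreeAlgebra.lift_ι_apply, Sum.elim_inl, Sum.elim_inr, hdx]
      split_ifs <;> simp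
  let F : WeylAlgebra K d →ₐ[K] Module.End K M := RingQuot.liftAlgHom K ⟨f, hf⟩
  have hF : ∀ s, F (gen K s) = Sum.elim X D s := fun s => by
    refine (RingQuot.liftAlgHom_mkAlgHom_apply K f hf _).trans ?_
    simp [f]
  refine ⟨Module.compHom M F.toRingHom, fun c m => ?_, fun i m => ?_, fun i m => ?_⟩
  · exact (congrArg (· m) (F.commutes c)).trans rfl
  · exact congrArg (· m) (hF (Sum.inl i))
  · exact congrArg (· m) (hF (Sum.inr i))

end WeylAlgebra

lemma X_mem_polyGrading (K : Type*) [Field K] {d : ℕ} (i : Fin d) :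
    (MvPolynomial.X i : MvPolynomial (Fin d) K) ∈ polyGrading K (Pi.single i 1) := by
  refine Submodule.subset_span ⟨Finsupp.single i 1, fun j => ?_, rfl⟩
  rcases eq_or_ne i j with rfl | hij
  · simp
  · simp [hij.symm]

section Straight

variable {K : Type*} [Field K] {d : ℕ} {M : Type*} [AddCommGroup M]
  [Module K M] [Module (MvPolynomial (Fin d) K) M]
  {ℳ : (Fin d → ℤ) → Submodule K M}

/-- Adding `e i` alters the positive support only when `u i = 0`. -/
lemma IsStraight.bijOn_X (hs : IsStraight ℳ) {u : Fin d → ℤ} {i : Fin d} (hu : u i ≠ 0) :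
    Set.BijOn (fun y : M => (MvPolynomial.X i : MvPolynomial (Fin d) K) • y)
      (ℳ u) (ℳ (Pi.single i 1 + u)) := by
  have hw : (fun j => ((Finsupp.single i 1 : Fin d →₀ ℕ) j : ℤ)) = Pi.single i 1 := by
    funext j
    rcases eq_or_ne i j with rfl | hij
    · simp
    · simp [hij.symm]
  have h := hs.bijOn u (Finsupp.single i 1)
  rw [hw] at h
  refine h (Set.ext fun j => ?_)
  simp only [suppPos, Set.mem_ofPred_eq, Pi.add_apply]
  rcases eq_or_ne i j with rfl | hij
  · rw [Pi.single_eq_same]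
    omega
  · rw [Pi.single_eq_of_ne hij.symm, zero_add]

lemma X_smul_mem (hM : IsMultigraded (polyGrading K) ℳ) {u : Fin d → ℤ} {y : M} (hy : y ∈ ℳ u)
    (i : Fin d) : (MvPolynomial.X i : MvPolynomial (Fin d) K) • y ∈ ℳ (Pi.single i 1 + u) :=
  hM.smul_mem _ _ _ (X_mem_polyGrading K i) _ hy

/-- This cancellation reduces the Weyl relations to identities multiplied by `X i`. -/
lemma IsStraight.eq_of_X_smul_eq (hs : IsStraight ℳ) {u : Fin d → ℤ} {i : Fin d} (hu : u i ≠ 0)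
    {y z : M} (hy : y ∈ ℳ u) (hz : z ∈ ℳ u)
    (h : (MvPolynomial.X i : MvPolynomial (Fin d) K) • y =
      (MvPolynomial.X i : MvPolynomial (Fin d) K) • z) : y = z :=
  (hs.bijOn_X hu).injOn hy hz h

variable [IsScalarTower K (MvPolynomial (Fin d) K) M]

/-- On the component of degree `u`, the derivative `∂ i` is `u i - 1` times the inverse of
multiplication by `X i`. -/
lemma IsStraight.exists_del (hM : IsMultigraded (polyGrading K) ℳ) (hs : IsStraight ℳ)
    (i : Fin d) : ∃ D : Module.End K M, ∀ u, ∀ y ∈ ℳ u, D y ∈ ℳ (u - Pi.single i 1) ∧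
      (MvPolynomial.X i : MvPolynomial (Fin d) K) • D y = (u i - 1) • y ∧ (u i = 1 → D y = 0) := by
  have h : ∀ u, ∃ f : ℳ u →ₗ[K] M, ∀ y : ℳ u, f y ∈ ℳ (u - Pi.single i 1) ∧
      (MvPolynomial.X i : MvPolynomial (Fin d) K) • f y = (u i - 1) • (y : M) ∧
        (u i = 1 → f y = 0) := by
    intro u
    by_cases hu : u i = 1
    · exact ⟨0, fun y => by simp [hu]⟩
    -- The source degree has `i`-th coordinate `u i - 1 ≠ 0`, so `X i` maps it bijectively onto `ℳ
    -- u`.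
    have hb := hs.bijOn_X (u := u - Pi.single i 1) (i := i) (by simp; omega)
    rw [add_sub_cancel] at hb
    let g : ℳ (u - Pi.single i 1) →ₗ[K] ℳ u :=
      (Algebra.lsmul K K M (MvPolynomial.X i : MvPolynomial (Fin d) K)).restrict hb.mapsTo
    have hg : Function.Bijective g := by
      refine ⟨fun y z hyz => Subtype.ext (hb.injOn y.2 z.2 (congrArg Subtype.val hyz)),
        fun y => ?_⟩
      obtain ⟨z, hz, hzy⟩ := hb.surjOn y.2
      exact ⟨⟨z, hz⟩, Subtype.ext hzy⟩
    let e := LinearEquiv.ofBijective g hg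
    refine ⟨(u i - 1) • ((ℳ (u - Pi.single i 1)).subtype.comp e.symm.toLinearMap), fun y => ?_⟩
    have hy : (MvPolynomial.X i : MvPolynomial (Fin d) K) • (e.symm y : M) = y :=
      congrArg Subtype.val (e.apply_symm_apply y)
    refine ⟨zsmul_mem (e.symm y).2 _, ?_, fun h => absurd h hu⟩
    refine (smul_comm _ (u i - 1) (e.symm y : M)).trans ?_
    rw [hy]
  choose f hf using h
  obtain ⟨D, hD⟩ := hM.isInternal.exists_linearMap f
  refine ⟨D, fun u y hy => ?_⟩
  rw [hD u ⟨y, hy⟩]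
  exact hf u ⟨y, hy⟩

/-- A straight module carries an action of the Weyl algebra for which its shift by `1` is graded
and Eulerian. -/
lemma IsStraight.exists_weylModule (hM : IsMultigraded (polyGrading K) ℳ) (hs : IsStraight ℳ) :
    ∃ _ : Module (WeylAlgebra K d) M, ExtendsPolyAction K M d ∧
      (∀ u, ∀ y ∈ ℳ u, ∀ i, WeylAlgebra.del K i • y ∈ ℳ (u - Pi.single i 1)) ∧
      (∀ u, ∀ y ∈ ℳ u, ∀ i, WeylAlgebra.euler K i • y = (u i - 1) • y) ∧
      ∀ u, ∀ i, u i = 1 → ∀ y ∈ ℳ u, WeylAlgebra.del K i • y = 0 := by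
  choose D hmem hXD hzero using fun i => hs.exists_del hM i
  have hDX : ∀ i u, ∀ y ∈ ℳ u,
      D i ((MvPolynomial.X i : MvPolynomial (Fin d) K) • y) = u i • y := by
    intro i u y hy
    have hX := X_smul_mem hM hy i
    -- When `u i = 0`, `X i • y` sits where `D i` is zero, matching the scalar `u i`; otherwise `X
    -- i` can be cancelled.
    by_cases hu : u i = 0
    · rw [hu, zero_smul]
      exact hzero i _ _ hX (by simp [hu])
    · refine hs.eq_of_X_smul_eq hu ?_ (zsmul_mem hy _) ?_
      · simpa using hmem i _ _ hX
      · rw [hXD i _ _ hX, smul_comm _ (u i)]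
        simp
  have hDXne : ∀ i j, i ≠ j → ∀ u, ∀ y ∈ ℳ u,
      D i ((MvPolynomial.X j : MvPolynomial (Fin d) K) • y) =
        (MvPolynomial.X j : MvPolynomial (Fin d) K) • D i y := by
    intro i j hij u y hy
    have hX := X_smul_mem hM hy j
    have hui : (Pi.single j 1 + u : Fin d → ℤ) i = u i := by simp [hij]
    by_cases hu : u i = 1
    · rw [hzero i _ _ hX (hui.trans hu), hzero i u y hy hu, smul_zero]
    · refine hs.eq_of_X_smul_eq (u := Pi.single j 1 + u - Pi.single i 1) (i := i) ?_
        (hmem i _ _ hX) ?_ ?_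
      · simp only [Pi.sub_apply, hui, Pi.single_eq_same]
        omega
      · rw [add_sub_assoc]
        exact X_smul_mem hM (hmem i u y hy) j
      · rw [hXD i _ _ hX, hui, smul_smul, mul_comm, ← smul_smul, hXD i u y hy, smul_comm]
  have hDD : ∀ i j, i ≠ j → ∀ u, ∀ y ∈ ℳ u, D i (D j y) = D j (D i y) := by
    intro i j hij u y hy
    have hj := hmem j u y hy
    have hi := hmem i u y hy
    have huj : (u - Pi.single j 1 : Fin d → ℤ) i = u i := by simp [hij]
    have hui : (u - Pi.single i 1 : Fin d → ℤ) j = u j := by simp [hij.symm]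
    by_cases h1 : u i = 1
    · rw [hzero i u y hy h1, map_zero, hzero i _ _ hj (huj.trans h1)]
    by_cases h2 : u j = 1
    · rw [hzero j u y hy h2, map_zero, hzero j _ _ hi (hui.trans h2)]
    have hji : D j (D i y) ∈ ℳ (u - Pi.single j 1 - Pi.single i 1) := by
      rw [sub_right_comm]
      exact hmem j _ _ hi
    refine hs.eq_of_X_smul_eq (u := u - Pi.single j 1 - Pi.single i 1) (i := i) ?_
      (hmem i _ _ hj) hji ?_
    · simp only [Pi.sub_apply] at huj ⊢
      rw [huj, Pi.single_eq_same]
      omega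
    rw [hXD i _ _ hj, huj, ← hDXne j i hij.symm _ _ hi, hXD i u y hy, map_zsmul]
  obtain ⟨inst, hK, hx, hdel⟩ := WeylAlgebra.exists_module
    (fun i => Algebra.lsmul K K M (MvPolynomial.X i : MvPolynomial (Fin d) K)) D
    (fun i j => by rw [← map_mul, mul_comm, map_mul])
    (fun i j => by
      rcases eq_or_ne i j with rfl | hij
      · rfl
      · exact hM.isInternal.linearMap_ext (hDD i j hij))
    (fun i j => by
      refine hM.isInternal.linearMap_ext fun u y hy => ?_
      rcases eq_or_ne i j with rfl | hij
      · simp [hDX i u y hy, hXD i u y hy, sub_smul]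
      · simp [hDXne i j hij u y hy, hij])
  refine ⟨inst, ⟨hK, hx⟩, fun u y hy i => ?_, fun u y hy i => ?_, fun u i hu y hy => ?_⟩
  · rw [hdel]
    exact hmem i u y hy
  · rw [WeylAlgebra.euler, mul_smul, hdel, hx]
    exact hXD i u y hy
  · rw [hdel]
    exact hzero i u y hy hu

end Straight

/-! ### Eulerian straight modules are holonomic -/

/-- The number of coordinate steps from `u` to the cube `{0, 1}^d`. -/
def cubeDist {d : ℕ} (u : Fin d → ℤ) : ℕ := ∑ i, (if 0 < u i then u i - 1 else -u i).toNat

/-- The point at distance `a` from a vertex of the cube `{0, 1}^d`, in the orthant of the vertex. -/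
def cubePoint {d : ℕ} (ε : Fin d → Bool) (a : Fin d → ℕ) : Fin d → ℤ :=
  fun i => if ε i then 1 + (a i : ℤ) else -(a i : ℤ)

lemma cubeDist_cubePoint {d : ℕ} (ε : Fin d → Bool) (a : Fin d → ℕ) :
    cubeDist (cubePoint ε a) = ∑ i, a i := by
  refine Finset.sum_congr rfl fun i _ => ?_
  simp only [cubePoint]
  split_ifs <;> omega

lemma exists_cubePoint_eq {d : ℕ} (u : Fin d → ℤ) :
    ∃ (ε : Fin d → Bool) (a : Fin d → ℕ), cubePoint ε a = u ∧ ∑ i, a i = cubeDist u := by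
  refine ⟨fun i => decide (0 < u i), fun i => (if 0 < u i then u i - 1 else -u i).toNat, ?_, rfl⟩
  funext i
  simp only [cubePoint, decide_eq_true_eq]
  split_ifs <;> omega

/-- The orthants at the `2^d` vertices are disjoint: `1 + a` and `-a'` never agree for natural `a`,
`a'`. -/
lemma cubePoint_injective {d : ℕ} :
    Function.Injective fun p : (Fin d → Bool) × (Fin d → ℕ) => cubePoint p.1 p.2 := by
  rintro ⟨ε, a⟩ ⟨ε', a'⟩ h
  have h' : ∀ i, ε i = ε' i ∧ a i = a' i := fun i => by
    have := congrFun h i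
    simp only [cubePoint] at this
    cases hε : ε i <;> cases hε' : ε' i <;> simp_all <;> omega
  exact Prod.ext (funext fun i => (h' i).1) (funext fun i => (h' i).2)

/-- The distance to the cube is 1-Lipschitz for the `ℓ¹` norm, and generators have degree of norm
one. -/
lemma cubeDist_genDegree_add_le {d : ℕ} (s : Fin d ⊕ Fin d) (u : Fin d → ℤ) :
    cubeDist (WeylAlgebra.genDegree s + u) ≤ cubeDist u + 1 := by
  have h1 : ∑ i, (WeylAlgebra.genDegree s i).natAbs = 1 := by
    rcases s with i | i <;>
    · rw [Finset.sum_eq_single i] <;> simp +contextual [WeylAlgebra.genDegree]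
  rw [← h1, cubeDist, cubeDist, ← Finset.sum_add_distrib]
  refine Finset.sum_le_sum fun i _ => ?_
  simp only [Pi.add_apply]
  split_ifs <;> omega

lemma cubeDist_lt {d : ℕ} {u v : Fin d → ℤ} (i : Fin d) (huv : ∀ j, j ≠ i → v j = u j)
    (hi : (1 < u i ∧ v i = u i - 1) ∨ (u i < 0 ∧ v i = u i + 1)) : cubeDist v < cubeDist u := by
  refine Finset.sum_lt_sum (fun j _ => ?_) ⟨i, Finset.mem_univ i, ?_⟩
  · rcases eq_or_ne j i with rfl | hj
    · split_ifs <;> omega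
    · rw [huv j hj]
  · split_ifs <;> omega

namespace WeylAlgebra

variable {K : Type*} [Field K] {d : ℕ} {M : Type*} [AddCommGroup M] [Module K M]
  [Module (WeylAlgebra K d) M] {ℳ : (Fin d → ℤ) → Submodule K M}

lemma prod_gen_smul_mem
    (hgen : ∀ (s : Fin d ⊕ Fin d) (u), ∀ y ∈ ℳ u, gen K s • y ∈ ℳ (genDegree s + u))
    (l : List (Fin d ⊕ Fin d)) (u : Fin d → ℤ) {y : M} (hy : y ∈ ℳ u) :
    (l.map (gen K)).prod • y ∈ ℳ ((l.map genDegree).sum + u) := by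
  induction l with
  | nil => simpa using hy
  | cons s l ih =>
    rw [List.map_cons, List.map_cons, List.prod_cons, mul_smul, List.sum_cons, add_assoc]
    exact hgen s _ _ ih

lemma isMultigraded_shiftGrading [IsScalarTower K (WeylAlgebra K d) M]
    (hint : DirectSum.IsInternal ℳ)
    (hgen : ∀ (s : Fin d ⊕ Fin d) (u), ∀ y ∈ ℳ u, gen K s • y ∈ ℳ (genDegree s + u))
    (a : Fin d → ℤ) : IsMultigraded (grading K) (shiftGrading ℳ a) := by
  refine ⟨?_, fun u v b hb m hm => ?_⟩
  · rw [DirectSum.isInternal_submodule_iff_iSupIndep_and_iSup_eq_top]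
    refine ⟨hint.submodule_iSupIndep.comp (add_left_injective a), ?_⟩
    rw [← hint.submodule_iSup_eq_top]
    exact (add_right_surjective a).iSup_comp ℳ
  · have hle : grading K u ≤
        (shiftGrading ℳ a (u + v)).comap ((Algebra.lsmul K K M).toLinearMap.flip m) := by
      refine Submodule.span_le.mpr ?_
      rintro _ ⟨l, rfl, rfl⟩
      have := prod_gen_smul_mem hgen l (v + a) hm
      rwa [← add_assoc] at this
    exact hle hb

/-- The sum of the components at distance at most `n` from the cube `{0, 1}^d`. -/
def cubeFiltration (ℳ : (Fin d → ℤ) → Submodule K M) (n : ℕ) : Submodule K M :=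
  ⨆ p : (Fin d → Bool) × boundedTuples d n, ℳ (cubePoint p.1 p.2)

omit [Module (WeylAlgebra K d) M] in
lemma le_cubeFiltration {n : ℕ} {u : Fin d → ℤ} (hu : cubeDist u ≤ n) :
    ℳ u ≤ cubeFiltration ℳ n := by
  obtain ⟨ε, a, rfl, ha⟩ := exists_cubePoint_eq u
  exact le_iSup (fun p : (Fin d → Bool) × boundedTuples d n => ℳ (cubePoint p.1 p.2))
    (ε, ⟨a, mem_boundedTuples.mpr (ha.trans_le hu)⟩)

omit [Module (WeylAlgebra K d) M] in
lemma cubeFiltration_le {n : ℕ} {N : Submodule K M} (h : ∀ u, cubeDist u ≤ n → ℳ u ≤ N) :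
    cubeFiltration ℳ n ≤ N :=
  iSup_le fun p => h _ ((cubeDist_cubePoint _ _).trans_le (mem_boundedTuples.mp p.2.2))

omit [Module (WeylAlgebra K d) M] in
lemma cubeFiltration_mono : Monotone (cubeFiltration ℳ) := fun _ _ h =>
  cubeFiltration_le fun _ hu => le_cubeFiltration (hu.trans h)

omit [Module (WeylAlgebra K d) M] in
lemma exists_mem_cubeFiltration (hint : DirectSum.IsInternal ℳ) (m : M) :
    ∃ n, m ∈ cubeFiltration ℳ n := by
  have hm : m ∈ iSup ℳ := hint.submodule_iSup_eq_top ▸ Submodule.mem_top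
  refine Submodule.iSup_induction ℳ (motive := fun m => ∃ n, m ∈ cubeFiltration ℳ n) hm
    (fun u y hy => ⟨_, le_cubeFiltration le_rfl hy⟩) ⟨0, Submodule.zero_mem _⟩ ?_
  rintro y z ⟨n, hn⟩ ⟨k, hk⟩
  exact ⟨max n k, Submodule.add_mem _ (cubeFiltration_mono (le_max_left n k) hn)
    (cubeFiltration_mono (le_max_right n k) hk)⟩

variable [IsScalarTower K (WeylAlgebra K d) M]

lemma smul_mem_cubeFiltration
    (hgen : ∀ (s : Fin d ⊕ Fin d) (u), ∀ y ∈ ℳ u, gen K s • y ∈ ℳ (genDegree s + u))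
    (m n : ℕ) {b : WeylAlgebra K d} (hb : b ∈ bernstein K d m) {y : M}
    (hy : y ∈ cubeFiltration ℳ n) : b • y ∈ cubeFiltration ℳ (m + n) := by
  have hstep : ∀ (s : Fin d ⊕ Fin d) (k : ℕ), ∀ z ∈ cubeFiltration ℳ k,
      gen K s • z ∈ cubeFiltration ℳ (1 + k) := by
    intro s k
    refine cubeFiltration_le (N := (cubeFiltration ℳ (1 + k)).comap
      (Algebra.lsmul K K M (gen K s))) fun u hu z hz => ?_
    refine le_cubeFiltration ((cubeDist_genDegree_add_le s u).trans ?_) (hgen s u z hz)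
    omega
  have hle : bernstein K d m ≤
      (cubeFiltration ℳ (m + n)).comap ((Algebra.lsmul K K M).toLinearMap.flip y) := by
    refine Submodule.span_le.mpr ?_
    rintro _ ⟨l, hl, rfl⟩
    have : (l.map (gen K)).prod • y ∈ cubeFiltration ℳ (l.length + n) := by
      clear hl
      induction l with
      | nil => simpa using hy
      | cons s l ih =>
        rw [List.map_cons, List.prod_cons, mul_smul, List.length_cons, add_comm l.length 1,
          add_assoc]
        exact hstep s _ _ ih
    exact cubeFiltration_mono (Nat.add_le_add_right hl n) this
  exact hle hb

/-- Off the cube `{0, 1}^d` every element of an Eulerian module is the image under a generator of an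
element of a component closer to the cube. -/
lemma exists_gen_smul_eq [CharZero K]
    (hgen : ∀ (s : Fin d ⊕ Fin d) (u), ∀ y ∈ ℳ u, gen K s • y ∈ ℳ (genDegree s + u))
    (heuler : ∀ u, ∀ y ∈ ℳ u, ∀ i, euler K i • y = (u i - 1) • y)
    {u : Fin d → ℤ} (hu : 0 < cubeDist u) {y : M} (hy : y ∈ ℳ u) :
    ∃ (s : Fin d ⊕ Fin d) (v : Fin d → ℤ), cubeDist v < cubeDist u ∧ ∃ z ∈ ℳ v, gen K s • z = y := by
  obtain ⟨i, -, hi⟩ := Finset.exists_ne_zero_of_sum_ne_zero hu.ne'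
  have hi' : 1 < u i ∨ u i < 0 := by
    split_ifs at hi <;> omega
  rcases hi' with h | h
  · have h0 : ((u i - 1 : ℤ) : K) ≠ 0 := Int.cast_ne_zero.mpr (by omega)
    refine ⟨Sum.inl i, genDegree (Sum.inr i) + u, cubeDist_lt i (fun j hj => ?_) (Or.inl ⟨h, ?_⟩),
      ((u i - 1 : ℤ) : K)⁻¹ • (gen K (Sum.inr i) • y),
      Submodule.smul_mem _ _ (hgen (Sum.inr i) u y hy), ?_⟩
    · simp [genDegree, hj]
    · simp [genDegree]
      ring
    · rw [smul_comm, ← mul_smul, show gen K (Sum.inl i) * gen K (Sum.inr i) = euler K i from rfl,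
        heuler u y hy, ← Int.cast_smul_eq_zsmul K, smul_smul, inv_mul_cancel₀ h0, one_smul]
  · have h0 : ((u i : ℤ) : K) ≠ 0 := Int.cast_ne_zero.mpr (by omega)
    refine ⟨Sum.inr i, genDegree (Sum.inl i) + u, cubeDist_lt i (fun j hj => ?_) (Or.inr ⟨h, ?_⟩),
      ((u i : ℤ) : K)⁻¹ • (gen K (Sum.inl i) • y),
      Submodule.smul_mem _ _ (hgen (Sum.inl i) u y hy), ?_⟩
    · simp [genDegree, hj]
    · simp [genDegree]
      ring
    · have h1 : (gen K (Sum.inr i) * gen K (Sum.inl i)) • y = (u i : K) • y := by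
        rw [show gen K (Sum.inr i) * gen K (Sum.inl i) = del K i * x K i from rfl, del_mul_x,
          if_pos rfl, add_smul, one_smul, show x K i * del K i = euler K i from rfl,
          heuler u y hy, sub_smul, one_smul, sub_add_cancel, Int.cast_smul_eq_zsmul]
      rw [smul_comm, ← mul_smul, h1, smul_smul, inv_mul_cancel₀ h0, one_smul]

/-- By induction on `m`: a component farther than `n` from the cube is the image under one generator
of a closer one. Equality holds from `n = 0` on, so the degree-zero step generates the module. -/
lemma cubeFiltration_add_eq_span [CharZero K]
    (hgen : ∀ (s : Fin d ⊕ Fin d) (u), ∀ y ∈ ℳ u, gen K s • y ∈ ℳ (genDegree s + u))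
    (heuler : ∀ u, ∀ y ∈ ℳ u, ∀ i, euler K i • y = (u i - 1) • y) (m n : ℕ) :
    cubeFiltration ℳ (m + n) = Submodule.span K
      {z | ∃ a ∈ bernstein K d m, ∃ y ∈ cubeFiltration ℳ n, a • y = z} := by
  refine le_antisymm ?_ (Submodule.span_le.mpr ?_)
  · suffices h : ∀ u, cubeDist u ≤ m + n → ℳ u ≤ Submodule.span K
        {z | ∃ a ∈ bernstein K d m, ∃ y ∈ cubeFiltration ℳ n, a • y = z} from cubeFiltration_le h
    induction m with
    | zero =>
      intro u hu y hy
      exact Submodule.subset_span ⟨1, one_mem_bernstein 0, y,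
        le_cubeFiltration (hu.trans (Nat.zero_add n).le) hy, one_smul _ y⟩
    | succ m ih =>
      intro u hu y hy
      by_cases hu' : cubeDist u ≤ n
      · exact Submodule.subset_span ⟨1, one_mem_bernstein _, y, le_cubeFiltration hu' hy,
          one_smul _ y⟩
      obtain ⟨s, v, hv, z, hz, rfl⟩ := exists_gen_smul_eq hgen heuler (by omega) hy
      have hle : Submodule.span K
          {z | ∃ a ∈ bernstein K d m, ∃ y ∈ cubeFiltration ℳ n, a • y = z} ≤
          (Submodule.span K
            {z | ∃ a ∈ bernstein K d (m + 1), ∃ y ∈ cubeFiltration ℳ n, a • y = z}).comap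
            (Algebra.lsmul K K M (gen K s)) := by
        refine Submodule.span_le.mpr ?_
        rintro _ ⟨a, ha, w, hw, rfl⟩
        refine Submodule.subset_span ⟨gen K s * a, ?_, w, hw, mul_smul _ _ _⟩
        rw [add_comm]
        exact mul_mem_bernstein (gen_mem_bernstein s) ha
      exact hle (ih v (by omega) hz)
  · rintro _ ⟨a, ha, y, hy, rfl⟩
    exact smul_mem_cubeFiltration hgen m n ha hy

lemma isGoodFiltration_cubeFiltration [CharZero K] (hint : DirectSum.IsInternal ℳ)
    (hfin : ∀ u, Module.Finite K (ℳ u))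
    (hgen : ∀ (s : Fin d ⊕ Fin d) (u), ∀ y ∈ ℳ u, gen K s • y ∈ ℳ (genDegree s + u))
    (heuler : ∀ u, ∀ y ∈ ℳ u, ∀ i, euler K i • y = (u i - 1) • y) :
    IsGoodFiltration K d (cubeFiltration ℳ) where
  mono := cubeFiltration_mono
  exhaustive := exists_mem_cubeFiltration hint
  finite n := by
    rw [cubeFiltration]
    infer_instance
  smul_mem m n _ ha _ hy := smul_mem_cubeFiltration hgen m n ha hy
  good := ⟨0, fun m n _ => cubeFiltration_add_eq_span hgen heuler m n⟩

-- Each orthant contributes the dimension at its vertex, once for every tuple of sum at most `n`.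
omit [IsScalarTower K (WeylAlgebra K d) M] [Module (WeylAlgebra K d) M] in
lemma finrank_cubeFiltration (hint : DirectSum.IsInternal ℳ)
    (hfin : ∀ u, Module.Finite K (ℳ u))
    (hrank : ∀ ε a, finrank K (ℳ (cubePoint ε a)) = finrank K (ℳ (cubePoint ε 0))) (n : ℕ) :
    finrank K (cubeFiltration ℳ n) =
      (∑ ε, finrank K (ℳ (cubePoint ε 0))) * (boundedTuples d n).card := by
  have hinj : Function.Injective
      fun p : (Fin d → Bool) × boundedTuples d n => cubePoint p.1 (p.2 : Fin d → ℕ) :=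
    cubePoint_injective.comp (Function.injective_id.prodMap Subtype.coe_injective)
  rw [cubeFiltration, finrank_iSup_of_iSupIndep
    (p := fun p : (Fin d → Bool) × boundedTuples d n => ℳ (cubePoint p.1 p.2))
    (hint.submodule_iSupIndep.comp hinj), Fintype.sum_prod_type, Finset.sum_mul]
  refine Finset.sum_congr rfl fun ε _ => ?_
  refine (Finset.sum_congr rfl fun a _ => hrank ε a.1).trans ?_
  rw [Finset.sum_const, Finset.card_univ, Fintype.card_coe, smul_eq_mul, mul_comm]

/-- A graded Eulerian module whose components are finite dimensional, of constant dimension along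
each orthant, is holonomic. -/
lemma isHolonomic_of_finrank_eq [CharZero K] (hint : DirectSum.IsInternal ℳ)
    (hfin : ∀ u, Module.Finite K (ℳ u))
    (hgen : ∀ (s : Fin d ⊕ Fin d) (u), ∀ y ∈ ℳ u, gen K s • y ∈ ℳ (genDegree s + u))
    (heuler : ∀ u, ∀ y ∈ ℳ u, ∀ i, euler K i • y = (u i - 1) • y)
    (hrank : ∀ ε a, finrank K (ℳ (cubePoint ε a)) = finrank K (ℳ (cubePoint ε 0))) :
    IsHolonomic K M d := by
  have hΓ := isGoodFiltration_cubeFiltration hint hfin hgen heuler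
  refine ⟨?_, ?_⟩
  · obtain ⟨s, hs⟩ := Module.Finite.iff_fg.mp (hΓ.finite 0)
    refine ⟨⟨s, eq_top_iff.mpr fun m _ => ?_⟩⟩
    have h0 : cubeFiltration ℳ 0 ≤
        (Submodule.span (WeylAlgebra K d) (s : Set M)).restrictScalars K := by
      rw [← hs]
      exact Submodule.span_le_restrictScalars K (WeylAlgebra K d) (s : Set M)
    obtain ⟨n, hn⟩ := hΓ.exhaustive m
    have hle : cubeFiltration ℳ (n + 0) ≤
        (Submodule.span (WeylAlgebra K d) (s : Set M)).restrictScalars K := by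
      rw [cubeFiltration_add_eq_span hgen heuler]
      refine Submodule.span_le.mpr ?_
      rintro _ ⟨a, _, y, hy, rfl⟩
      exact Submodule.smul_mem _ a (h0 hy)
    exact hle hn
  · by_cases hN : ∑ ε, finrank K (ℳ (cubePoint ε 0)) = 0
    · left
      have hbot : ∀ u, ℳ u = ⊥ := fun u => by
        obtain ⟨ε, a, rfl, -⟩ := exists_cubePoint_eq u
        have := hfin (cubePoint ε a)
        rw [← Submodule.finrank_eq_zero, hrank]
        exact Finset.sum_eq_zero_iff.mp hN ε (Finset.mem_univ ε)
      rw [← Submodule.subsingleton_iff K, ← subsingleton_iff_bot_eq_top,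
        ← hint.submodule_iSup_eq_top]
      exact (iSup_eq_bot.mpr hbot).symm
    · right
      refine ⟨_, hΓ, Polynomial.C ((∑ ε, finrank K (ℳ (cubePoint ε 0)) : ℕ) : ℚ) *
        Polynomial.preHilbertPoly ℚ d 0, ?_, Filter.Eventually.of_forall fun n => ?_⟩
      · rw [Polynomial.degree_C_mul (Nat.cast_ne_zero.mpr hN), degree_preHilbertPoly_zero]
      · rw [finrank_cubeFiltration hint hfin hrank, Polynomial.eval_mul, Polynomial.eval_C,
          eval_preHilbertPoly_zero, Nat.cast_mul]

end WeylAlgebra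

/-! ### Constancy of dimension along orthants, and the theorem -/

section Straight

variable {K : Type*} [Field K] {d : ℕ} {M : Type*} [AddCommGroup M]
  [Module K M] [Module (MvPolynomial (Fin d) K) M] [IsScalarTower K (MvPolynomial (Fin d) K) M]
  {ℳ : (Fin d → ℤ) → Submodule K M}

lemma IsStraight.finrank_add_eq (hs : IsStraight ℳ) (u : Fin d → ℤ) (w : Fin d →₀ ℕ)
    (h : suppPos ((fun i => (w i : ℤ)) + u) = suppPos u) :
    finrank K (ℳ ((fun i => (w i : ℤ)) + u)) = finrank K (ℳ u) := by
  have hb := hs.bijOn u w h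
  let g : ℳ u →ₗ[K] ℳ ((fun i => (w i : ℤ)) + u) :=
    (Algebra.lsmul K K M (MvPolynomial.monomial w 1 : MvPolynomial (Fin d) K)).restrict hb.mapsTo
  have hg : Function.Bijective g := by
    refine ⟨fun y z hyz => Subtype.ext (hb.injOn y.2 z.2 (congrArg Subtype.val hyz)), fun y => ?_⟩
    obtain ⟨z, hz, hzy⟩ := hb.surjOn y.2
    exact ⟨⟨z, hz⟩, Subtype.ext hzy⟩
  exact (LinearEquiv.ofBijective g hg).finrank_eq.symm

/-- Neither degree need dominate the other. Both are compared with the degree having `1 + a i` where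
`ε i` holds and `0` elsewhere, reached from each without changing the positive support. -/
lemma IsStraight.finrank_cubePoint (hs : IsStraight ℳ) (ε : Fin d → Bool) (a : Fin d → ℕ) :
    finrank K (ℳ (cubePoint ε a)) = finrank K (ℳ (cubePoint ε 0)) := by
  let w : Fin d →₀ ℕ := Finsupp.equivFunOnFinite.symm fun i => if ε i then 0 else a i
  let w' : Fin d →₀ ℕ := Finsupp.equivFunOnFinite.symm fun i => if ε i then a i else 0
  have hw : (fun i => (w i : ℤ)) + cubePoint ε a = (fun i => (w' i : ℤ)) + cubePoint ε 0 := by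
    funext i
    simp only [w, w', cubePoint, Finsupp.equivFunOnFinite_symm_apply_apply, Pi.add_apply,
      Pi.zero_apply]
    split_ifs <;> push_cast <;> ring
  have h1 : suppPos (cubePoint ε a) = {i | ε i} := by
    ext i
    simp only [suppPos, cubePoint, Set.mem_ofPred_eq]
    split_ifs with h
    · simp only [h, iff_true]
      omega
    · simp [h]
  have h2 : suppPos (cubePoint ε 0) = {i | ε i} := by
    ext i
    simp only [suppPos, cubePoint, Set.mem_ofPred_eq]
    split_ifs with h <;> simp [h]
  have h3 : suppPos ((fun i => (w' i : ℤ)) + cubePoint ε 0) = {i | ε i} := by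
    ext i
    simp only [suppPos, cubePoint, Set.mem_ofPred_eq, w', Pi.add_apply,
      Finsupp.equivFunOnFinite_symm_apply_apply]
    split_ifs with h <;> simp [h]
  rw [← hs.finrank_add_eq (cubePoint ε a) w (by rw [hw, h3, h1]), hw,
    hs.finrank_add_eq _ w' (by rw [h3, h2])]

end Straight

theorem theorem4p4 {K : Type*} [Field K] [CharZero K] {d : ℕ} {M : Type*} [AddCommGroup M]
    [Module K M] [Module (MvPolynomial (Fin d) K) M] [IsScalarTower K (MvPolynomial (Fin d) K) M]
    (ℳ : (Fin d → ℤ) → Submodule K M) (hM : IsMultigraded (polyGrading K) ℳ) :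
    (IsStraight ℳ →
      ∃ _ : Module (WeylAlgebra K d) M,
        ExtendsPolyAction K M d ∧
        (∀ (u : Fin d → ℤ) (i : Fin d), u i = 1 → ∀ m ∈ ℳ u, WeylAlgebra.del K i • m = 0) ∧
        IsMultigraded (WeylAlgebra.grading K) (shiftGrading ℳ 1) ∧
        IsEulerian (shiftGrading ℳ 1) ∧
        IsHolonomic K M d) ∧
    (∀ _ : Module (WeylAlgebra K d) M,
      ExtendsPolyAction K M d →
      IsMultigraded (WeylAlgebra.grading K) (shiftGrading ℳ 1) →
      IsGeneralizedEulerian (shiftGrading ℳ 1) →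
      IsHolonomic K M d →
      IsStraight ℳ) := by
  refine ⟨fun hs => ?_, fun _ hE hgr hgen hhol =>
    isStraight_of_isGeneralizedEulerian hE hgr hgen hhol⟩
  obtain ⟨inst, hE, hdel, heuler, hzero⟩ := hs.exists_weylModule hM
  have : IsScalarTower K (WeylAlgebra K d) M := ⟨fun c a m => by
    rw [Algebra.smul_def, mul_smul, hE.algebraMap_smul]⟩
  have hgen : ∀ (s : Fin d ⊕ Fin d) (u), ∀ y ∈ ℳ u,
      WeylAlgebra.gen K s • y ∈ ℳ (WeylAlgebra.genDegree s + u) := by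
    rintro (i | i) u y hy
    · exact (hE.x_smul i y).symm ▸ X_smul_mem hM hy i
    · have := hdel u y hy i
      rwa [sub_eq_add_neg, add_comm] at this
  refine ⟨inst, hE, fun u i hu y hy => hzero u i hu y hy,
    WeylAlgebra.isMultigraded_shiftGrading hM.isInternal hgen 1, fun u y hy i => ?_,
    WeylAlgebra.isHolonomic_of_finrank_eq hM.isInternal hs.finite hgen heuler hs.finrank_cubePoint⟩
  -- The shifted component of degree `u` is `ℳ (u + 1)`, where the Euler scalar is `(u i + 1) - 1`.
  rw [heuler _ y hy, Pi.add_apply, Pi.one_apply, add_sub_cancel_right]
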